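/- Let $N\ge 1$, $c>0$, $\alpha>0$ with $\alpha\neq 1$. For $k=1,\dots,N$ let $a_k>0$, $\gamma_k\in[0,1]$, $b_k\in(0,1)$ with $2-\alpha-\gamma_k\neq 0$, and let $x_k(0)>0$. Between impulses the allocation of user $k$ follows $\dot x_k=a_kx_k^{\gamma_k}$, and an impulse at time $t$ resets it to $x_k(t+0)=b_kx_k(t)$. For an impulse policy $T$ (a nondecreasing sequence of impulse times in $[0,\infty]$ tending to $\infty$) put $$J_k(T)=\liminf_{\tau\to\infty}\frac1\tau\int_0^\tau\frac{x_k(t)^{1-\alpha}}{1-\alpha}\,dt,\qquad G_k(T)=\limsup_{\tau\to\infty}\frac1\tau\int_0^\tau x_k(t)\,dt .$$ For $\lambda>0$ let $u_k^*(\lambda)$ be the threshold policy that gives an impulse to user $k$ as soon as $x_k(t)\ge\bar x_k(\lambda)$, where $$\bar x_k(\lambda)=\left\{\frac{(2-\gamma_k)(1-b_k^{2-\alpha-\gamma_k})}{(1-b_k^{2-\gamma_k})(2-\alpha-\gamma_k)\lambda}\right\}^{1/\alpha},$$ let $\Omega_k\subset\mathbb R^2$ be the convex hull of the curve $\{(-J_k(u_k^*(\lambda)),\,G_k(u_k^*(\lambda))):\lambda>0\}$,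 and let $\Omega=\prod_{k=1}^N\Omega_k$. For $\omega=((\omega_k^1,\omega_k^2))_{k=1}^N\in\Omega$ put $-\tilde J(\omega)=\sum_k\omega^1_k$ and $\tilde G(\omega)=\sum_k\omega_k^2$, and consider the convex problem of minimizing $-\tilde J(\omega)$ over $\omega\in\Omega$ subject to $\tilde G(\omega)-c\le 0$. A number $\lambda\ge 0$ is called a geometric multiplier for this problem if $$\inf_{\omega\in\Omega,\ \tilde G(\omega)\le c}\bigl(-\tilde J(\omega)\bigr)=\inf_{\omega\in\Omega}\bigl\{-\tilde J(\omega)+\lambda(\tilde G(\omega)-c)\bigr\}$$ (infima in $[-\infty,\infty]$). Then $$\lambda^*=\frac1{c^\alpha}\Biggl(\sum_{k:\gamma_k\ne1}\frac{1-\gamma_k}{2-\gamma_k}\,\frac{1-b_k^{2-\gamma_k}}{1-b_k^{1-\gamma_k}}\left(\frac{2-\gamma_k}{1-b_k^{2-\gamma_k}}\right)^{1/\alpha}\left(\frac{1-b_k^{2-\alpha-\gamma_k}}{2-\alpha-\gamma_k}\right)^{1/\alpha}+\sum_{k:\gamma_k=1}\left(\frac{1-b_k^{1-\alpha}}{1-\alpha}\right)^{1/\alpha}\frac{(1-b_k)^{(\alpha-1)/\alpha}}{-\ln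 b_k}\Biggr)^{\alpha}$$ is a geometric multiplier for this problem, and it is the only one. -/

import Mathlib

open Filter Topology
open scoped ENNReal

noncomputable section

namespace GAIMD

/-- A user of the G-AIMD system: rate coefficient `a > 0`, growth exponent `γ ∈ [0,1]`,
multiplicative decrease factor `b ∈ (0,1)` and initial allocation `x₀ > 0`. -/
structure User where
  a : ℝ
  γ : ℝ
  b : ℝ
  x₀ : ℝ
  a_pos : 0 < a
  γ_nonneg : 0 ≤ γ
  γ_le_one : γ ≤ 1
  b_pos : 0 < b
  b_lt_one : b < 1
  x₀_pos : 0 < x₀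

/-- The allocation, `t` time units later and without impulses, of a user whose allocation is `y`:
the solution of `dx/dt = a x ^ γ`, `x 0 = y`. -/
def User.flow (u : User) (y t : ℝ) : ℝ :=
  if u.γ = 1 then y * Real.exp (u.a * t)
  else (y ^ (1 - u.γ) + (1 - u.γ) * u.a * t) ^ (1 / (1 - u.γ))

theorem User.flow_zero (u : User) {y : ℝ} (hy : 0 < y) : u.flow y 0 = y := by
  unfold User.flow
  split_ifs with h
  · simp
  · have h1 : (1 - u.γ) ≠ 0 := fun h2 => h (by linarith)
    rw [mul_zero, add_zero, ← Real.rpow_mul hy.le, mul_one_div_cancel h1, Real.rpow_one]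

theorem User.hasDerivAt_flow (u : User) {y t : ℝ} (hy : 0 < y) (ht : 0 ≤ t) :
    HasDerivAt (u.flow y) (u.a * (u.flow y t) ^ u.γ) t := by
  by_cases h : u.γ = 1
  · have e : u.flow y = fun t => y * Real.exp (u.a * t) := by
      funext s; simp [User.flow, h]
    rw [e, h]
    have := (((hasDerivAt_id t).const_mul u.a).exp).const_mul y
    simp only [id, mul_one] at this
    refine this.congr_deriv ?_
    rw [Real.rpow_one]; ring
  · have h1 : 0 < 1 - u.γ := by
      have := lt_of_le_of_ne u.γ_le_one h
      linarith
    have e : u.flow y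
        = fun t => (y ^ (1 - u.γ) + (1 - u.γ) * u.a * t) ^ (1 / (1 - u.γ)) := by
      funext s; simp [User.flow, h]
    have hp : 0 < y ^ (1 - u.γ) + (1 - u.γ) * u.a * t := by
      have := u.a_pos
      have := Real.rpow_pos_of_pos hy (1 - u.γ)
      positivity
    rw [e]
    have := (((hasDerivAt_id t).const_mul ((1 - u.γ) * u.a)).const_add
      (y ^ (1 - u.γ))).rpow_const (p := 1 / (1 - u.γ)) (Or.inl hp.ne')
    simp only [id, mul_one] at this
    refine this.congr_deriv ?_
    rw [← Real.rpow_mul hp.le]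
    have e2 : 1 / (1 - u.γ) - 1 = 1 / (1 - u.γ) * u.γ := by field_simp; ring
    rw [e2]; field_simp

/-- A (deterministic) impulse policy: a nondecreasing sequence of impulse times in `[0,∞]` that
tends to `∞`. Here `time n` is the time of the `(n+1)`-st impulse. Several impulses may share one
time. -/
structure Policy where
  time : ℕ → ℝ≥0∞
  mono : Monotone time
  tendsto_top : Tendsto time atTop (𝓝 ⊤)

/-- The time at which the period with exactly `n` impulses behind it begins: `0` for `n = 0`, and
the time of the `n`-th impulse otherwise. -/
def Policy.start (T : Policy) : ℕ → ℝ≥0∞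
  | 0 => 0
  | n + 1 => T.time n

/-- The number of impulses strictly before time `t`. -/
def Policy.count (T : Policy) (t : ℝ) : ℕ :=
  {i : ℕ | T.time i < ENNReal.ofReal t}.ncard

/-- The allocation just after the `n`-th impulse (the initial one for `n = 0`). -/
def User.postState (u : User) (T : Policy) : ℕ → ℝ
  | 0 => u.x₀
  | n + 1 => u.b * u.flow (u.postState T n) (T.start (n + 1) - T.start n).toReal

/-- The allocation `x(t)` at time `t ≥ 0` under the policy `T`. It is left continuous, and
`x(t+0) = b x(t)` at an impulse. -/
def User.state (u : User) (T : Policy) (t : ℝ) : ℝ :=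
  u.flow (u.postState T (T.count t)) (t - (T.start (T.count t)).toReal)

/-- The long-run average `α`-fair utility of a user under the policy `T`. -/
def User.J (u : User) (α : ℝ) (T : Policy) : EReal :=
  liminf (fun τ : ℝ =>
    (((1 / τ) * ∫ t in (0 : ℝ)..τ, (u.state T t) ^ (1 - α) / (1 - α) : ℝ) : EReal)) atTop

/-- The long-run average allocation of a user under the policy `T`. -/
def User.G (u : User) (T : Policy) : EReal :=
  limsup (fun τ : ℝ => (((1 / τ) * ∫ t in (0 : ℝ)..τ, u.state T t : ℝ) : EReal)) atTop

/-- `T` is the threshold policy with threshold `xbar`: the next impulse is always given as soon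
as the allocation is at least `xbar`. -/
def User.IsThresholdPolicy (u : User) (xbar : ℝ) (T : Policy) : Prop :=
  ∀ n : ℕ, ∃ s : ℝ, IsLeast {s : ℝ | 0 ≤ s ∧ xbar ≤ u.flow (u.postState T n) s} s ∧
    T.time n = T.start n + ENNReal.ofReal s

/-- The threshold `x̄(lam)`. -/
def User.threshold (u : User) (α lam : ℝ) : ℝ :=
  ((2 - u.γ) * (1 - u.b ^ (2 - α - u.γ)) /
    ((1 - u.b ^ (2 - u.γ)) * (2 - α - u.γ) * lam)) ^ (1 / α)

/-- The performance curve: the points `(-J, G)` of the threshold policies with the thresholds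
`x̄(lam)`, `lam > 0`. -/
def User.performanceCurve (u : User) (α : ℝ) : Set (ℝ × ℝ) :=
  {p | ∃ lam : ℝ, 0 < lam ∧ ∃ T : Policy, u.IsThresholdPolicy (u.threshold α lam) T ∧
    (p.1 : EReal) = -u.J α T ∧ (p.2 : EReal) = u.G T}

/-- The performance space `Ω = ∏ Ω_k`, where `Ω_k` is the convex hull of the performance curve
of user `k`. -/
def performanceSpace {N : ℕ} (u : Fin N → User) (α : ℝ) : Set (Fin N → ℝ × ℝ) :=
  Set.univ.pi fun k => convexHull ℝ ((u k).performanceCurve α)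

/-- The objective `-J̃(ω) = ∑ ω_k¹`. -/
def negJtilde {N : ℕ} (ω : Fin N → ℝ × ℝ) : ℝ := ∑ k, (ω k).1

/-- The constraint function `G̃(ω) = ∑ ω_k²`. -/
def Gtilde {N : ℕ} (ω : Fin N → ℝ × ℝ) : ℝ := ∑ k, (ω k).2

/-- `lam` is a geometric multiplier for the problem of minimizing `f` over `ω ∈ Ω` subject to
`g ω ≤ 0`. Infima are taken in the extended reals. -/
def IsGeometricMultiplier {X : Type*} (Ω : Set X) (f g : X → ℝ) (lam : ℝ) : Prop :=
  0 ≤ lam ∧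
    (⨅ ω ∈ {ω ∈ Ω | g ω ≤ 0}, (f ω : EReal)) = ⨅ ω ∈ Ω, ((f ω + lam * g ω : ℝ) : EReal)

/-- The multiplier `λ*`. -/
def lambdaStar {N : ℕ} (u : Fin N → User) (α c : ℝ) : ℝ :=
  1 / c ^ α *
    ((∑ k with (u k).γ ≠ 1,
        (1 - (u k).γ) / (2 - (u k).γ) *
          ((1 - (u k).b ^ (2 - (u k).γ)) / (1 - (u k).b ^ (1 - (u k).γ))) *
          ((2 - (u k).γ) / (1 - (u k).b ^ (2 - (u k).γ))) ^ (1 / α) *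
          ((1 - (u k).b ^ (2 - α - (u k).γ)) / (2 - α - (u k).γ)) ^ (1 / α)) +
      ∑ k with (u k).γ = 1,
        ((1 - (u k).b ^ (1 - α)) / (1 - α)) ^ (1 / α) *
          ((1 - (u k).b) ^ ((α - 1) / α) / (-Real.log (u k).b))) ^ α

end GAIMD

end

/-!
Under the policy with threshold `x`, the allocation of a user is, after finitely many impulses,
periodic: it runs along the flow from `b x` to `x` and is reset to `b x`. Substituting the
allocation for time, `dt = x ^ (-γ) dx / a`, gives the averages over a period in closed form, and
the long-run averages are those over a period (`User.IsThresholdPolicy.tendsto_average_rpow`).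
With `m p = ∫ x in b..1, x ^ (p - γ)` the performance curve is therefore
`{(-(m (1-α) / m 0) x ^ (1-α) / (1-α), (m 1 / m 0) x) : x > 0}` (`User.mem_performanceCurve`).
The only case that needs a logarithm is the period length for `γ = 1`.

On this curve the first coordinate is a strictly convex function of the second, and the threshold
`x̄(lam)` is the point at which the derivative of the one-user Lagrangian
`ω ↦ ω.1 + lam * ω.2` vanishes. Bernoulli's inequality makes it a global minimizer
(`User.lagrangian_threshold_le`), on the convex hull as well, because the Lagrangian is affine.
For `lam = λ*` the average allocations at the thresholds `x̄(λ*)` add up to `c`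
(`sum_point_threshold_lambdaStar`). So the corresponding point of `Ω` is feasible, satisfies the
constraint with equality and minimizes the Lagrangian: it is a primal optimum and `λ*` is a
multiplier. Any other multiplier `lam` must have the same point as minimizer of its Lagrangian
(`isGeometricMultiplier_iff`); moving the threshold of a single user, the vanishing of the
derivative forces `lam = λ*` (`User.eq_of_threshold_minimizes`).
-/

namespace GAIMD

/-! ### Moments and the flow -/

/-- The integral `∫ x in b..1, x ^ (p - γ)` in closed form. Up to the factor `1 / a` and a power of
the threshold, it is the integral of `x(t) ^ p` over one period of a threshold policy; `p = 0` gives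
the length of the period. -/
noncomputable def User.moment (u : User) (p : ℝ) : ℝ :=
  if p + 1 - u.γ = 0 then -Real.log u.b else (1 - u.b ^ (p + 1 - u.γ)) / (p + 1 - u.γ)

theorem User.moment_pos (u : User) (p : ℝ) : 0 < u.moment p := by
  unfold User.moment
  split_ifs with h
  · exact neg_pos.2 (Real.log_neg u.b_pos u.b_lt_one)
  · rcases lt_or_gt_of_ne h with h | h
    · exact div_pos_of_neg_of_neg
        (sub_neg.2 (Real.one_lt_rpow_of_pos_of_lt_one_of_neg u.b_pos u.b_lt_one h)) h
    · exact div_pos (sub_pos.2 (Real.rpow_lt_one u.b_pos.le u.b_lt_one h)) h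

/-- The time at which the flow from `y` reaches `xbar`; it is negative if `xbar < y`. -/
noncomputable def User.hitTime (u : User) (xbar y : ℝ) : ℝ :=
  if u.γ = 1 then Real.log (xbar / y) / u.a
  else (xbar ^ (1 - u.γ) - y ^ (1 - u.γ)) / ((1 - u.γ) * u.a)

theorem User.one_sub_γ_pos (u : User) (h : u.γ ≠ 1) : 0 < 1 - u.γ :=
  sub_pos.2 (lt_of_le_of_ne u.γ_le_one h)

theorem User.flow_hitTime (u : User) {xbar y : ℝ} (hx : 0 < xbar) (hy : 0 < y) :
    u.flow y (u.hitTime xbar y) = xbar := by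
  have ha := u.a_pos
  unfold User.flow User.hitTime
  split_ifs with h
  · rw [mul_div_cancel₀ _ ha.ne', Real.exp_log (div_pos hx hy)]
    field_simp
  · have h1 := u.one_sub_γ_pos h
    rw [mul_div_cancel₀ _ (mul_pos h1 ha).ne', add_sub_cancel, ← Real.rpow_mul hx.le,
      mul_one_div_cancel h1.ne', Real.rpow_one]

theorem User.hitTime_pos (u : User) {xbar y : ℝ} (hy : 0 < y) (hyx : y < xbar) :
    0 < u.hitTime xbar y := by
  have ha := u.a_pos
  unfold User.hitTime
  split_ifs with h
  · exact div_pos (Real.log_pos ((one_lt_div hy).2 hyx)) ha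
  · have h1 := u.one_sub_γ_pos h
    exact div_pos (sub_pos.2 (Real.rpow_lt_rpow hy.le hyx h1)) (mul_pos h1 ha)

theorem User.hitTime_b_mul (u : User) {xbar : ℝ} (hx : 0 < xbar) :
    u.hitTime xbar (u.b * xbar) = xbar ^ (1 - u.γ) * u.moment 0 / u.a := by
  have ha := u.a_pos
  have hb := u.b_pos
  unfold User.hitTime User.moment
  by_cases h : u.γ = 1
  · have e : xbar / (u.b * xbar) = u.b⁻¹ := by field_simp
    simp [h, e]
  · have h1 := u.one_sub_γ_pos h
    have h2 : (0 : ℝ) + 1 - u.γ ≠ 0 := by linarith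
    rw [if_neg h, if_neg h2, zero_add, Real.mul_rpow hb.le hx.le]
    field_simp

theorem User.flow_pos (u : User) {y t : ℝ} (hy : 0 < y) (ht : 0 ≤ t) : 0 < u.flow y t := by
  have ha := u.a_pos
  unfold User.flow
  split_ifs with h
  · positivity
  · have h1 := u.one_sub_γ_pos h
    positivity

theorem User.continuousOn_flow (u : User) {y : ℝ} (hy : 0 < y) :
    ContinuousOn (u.flow y) (Set.Ici 0) :=
  fun _ ht => (u.hasDerivAt_flow hy ht).continuousAt.continuousWithinAt

theorem User.strictMonoOn_flow (u : User) {y : ℝ} (hy : 0 < y) :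
    StrictMonoOn (u.flow y) (Set.Ici 0) := by
  refine strictMonoOn_of_deriv_pos (convex_Ici 0) (u.continuousOn_flow hy) fun t ht => ?_
  rw [interior_Ici] at ht
  have ht' : (0 : ℝ) ≤ t := le_of_lt ht
  rw [(u.hasDerivAt_flow hy ht').deriv]
  exact mul_pos u.a_pos (Real.rpow_pos_of_pos (u.flow_pos hy ht') _)

/-- Along the flow, `x ^ p dt = x ^ (p - γ) dx / a`. -/
theorem User.integral_flow_rpow (u : User) {xbar p : ℝ} (hx : 0 < xbar)
    (hp : p + 1 - u.γ ≠ 0) :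
    ∫ t in (0 : ℝ)..u.hitTime xbar (u.b * xbar), u.flow (u.b * xbar) t ^ p =
      xbar ^ (p + 1 - u.γ) * u.moment p / u.a := by
  have ha := u.a_pos
  have hb := u.b_pos
  have hy : 0 < u.b * xbar := mul_pos hb hx
  have hP : 0 < u.hitTime xbar (u.b * xbar) :=
    u.hitTime_pos hy (mul_lt_of_lt_one_left hx u.b_lt_one)
  have hd : ∀ t ∈ Set.uIcc 0 (u.hitTime xbar (u.b * xbar)),
      HasDerivAt (fun t => u.flow (u.b * xbar) t ^ (p + 1 - u.γ) / (u.a * (p + 1 - u.γ)))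
        (u.flow (u.b * xbar) t ^ p) t := by
    intro t ht
    rw [Set.uIcc_of_le hP.le] at ht
    have hf := u.flow_pos hy ht.1
    refine (((u.hasDerivAt_flow hy ht.1).rpow_const (Or.inl hf.ne')).div_const _).congr_deriv ?_
    have e : u.flow (u.b * xbar) t ^ p =
        u.flow (u.b * xbar) t ^ u.γ * u.flow (u.b * xbar) t ^ (p + 1 - u.γ - 1) := by
      rw [← Real.rpow_add hf]; congr 1; ring
    rw [e]; field_simp
  rw [intervalIntegral.integral_eq_sub_of_hasDerivAt hd, u.flow_hitTime hx hy, u.flow_zero hy,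
    User.moment, if_neg hp, Real.mul_rpow hb.le hx.le]
  · field_simp
  · refine ContinuousOn.intervalIntegrable ?_
    rw [Set.uIcc_of_le hP.le]
    exact ((u.continuousOn_flow hy).mono Set.Icc_subset_Ici_self).rpow_const
      fun t ht => Or.inl (u.flow_pos hy ht.1).ne'

/-! ### Threshold policies -/

/-- The time after which a user with allocation `y` receives the next impulse of the threshold
policy. -/
noncomputable def User.wait (u : User) (xbar y : ℝ) : ℝ :=
  if y < xbar then u.hitTime xbar y else 0

theorem User.wait_nonneg (u : User) {xbar y : ℝ} (hy : 0 < y) : 0 ≤ u.wait xbar y := by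
  unfold User.wait
  split_ifs with h
  · exact (u.hitTime_pos hy h).le
  · exact le_rfl

theorem User.flow_wait (u : User) {xbar y : ℝ} (hx : 0 < xbar) (hy : 0 < y) :
    u.flow y (u.wait xbar y) = max xbar y := by
  unfold User.wait
  split_ifs with h
  · rw [u.flow_hitTime hx hy, max_eq_left h.le]
  · rw [u.flow_zero hy, max_eq_right (not_lt.1 h)]

theorem User.isLeast_wait (u : User) {xbar y : ℝ} (hx : 0 < xbar) (hy : 0 < y) :
    IsLeast {s : ℝ | 0 ≤ s ∧ xbar ≤ u.flow y s} (u.wait xbar y) := by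
  refine ⟨⟨u.wait_nonneg hy, ?_⟩, fun s hs => ?_⟩
  · rw [u.flow_wait hx hy]; exact le_max_left _ _
  · by_cases h : y < xbar
    · rw [← (u.strictMonoOn_flow hy).le_iff_le (u.wait_nonneg hy) hs.1, u.flow_wait hx hy,
        max_eq_left h.le]
      exact hs.2
    · rw [User.wait, if_neg h]; exact hs.1

/-- The post-impulse allocations under a threshold policy decrease geometrically until they drop
below the threshold, and equal `b * xbar` from the next impulse on. -/
theorem User.exists_forall_ge_eq (u : User) {xbar : ℝ} (hx : 0 < xbar) {y : ℕ → ℝ}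
    (hy : ∀ n, y (n + 1) = u.b * max xbar (y n)) :
    ∃ m, ∀ n ≥ m, y n = u.b * xbar := by
  have hb := u.b_pos
  have hlt : ∃ n, y n < xbar := by
    by_contra! h
    have hpow : ∀ n, y n = u.b ^ n * y 0 := by
      intro n
      induction n with
      | zero => simp
      | succ n ih => rw [hy, max_eq_right (h n), ih]; ring
    have hlim : Tendsto y atTop (𝓝 0) := by
      have := (tendsto_pow_atTop_nhds_zero_of_lt_one hb.le u.b_lt_one).mul_const (y 0)
      rw [zero_mul] at this
      exact this.congr fun n => (hpow n).symm
    exact absurd (ge_of_tendsto' hlim h) (not_le.2 hx)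
  obtain ⟨m, hm⟩ := hlt
  refine ⟨m + 1, fun n hn => ?_⟩
  induction n, hn using Nat.le_induction with
  | base => rw [hy, max_eq_left hm.le]
  | succ n _ ih =>
    rw [hy, ih, max_eq_left (mul_le_of_le_one_left hx.le u.b_lt_one.le)]

theorem User.postState_pos (u : User) (T : Policy) (n : ℕ) : 0 < u.postState T n := by
  induction n with
  | zero => exact u.x₀_pos
  | succ n ih => exact mul_pos u.b_pos (u.flow_pos ih ENNReal.toReal_nonneg)

theorem User.IsThresholdPolicy.start_succ {u : User} {xbar : ℝ} {T : Policy} (hx : 0 < xbar)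
    (hT : u.IsThresholdPolicy xbar T) (n : ℕ) :
    T.start (n + 1) = T.start n + ENNReal.ofReal (u.wait xbar (u.postState T n)) := by
  obtain ⟨s, hs, h⟩ := hT n
  rw [(u.isLeast_wait hx (u.postState_pos T n)).unique hs]
  exact h

theorem User.IsThresholdPolicy.start_ne_top {u : User} {xbar : ℝ} {T : Policy} (hx : 0 < xbar)
    (hT : u.IsThresholdPolicy xbar T) (n : ℕ) : T.start n ≠ ⊤ := by
  induction n with
  | zero => exact ENNReal.zero_ne_top
  | succ n ih => rw [hT.start_succ hx]; exact ENNReal.add_ne_top.2 ⟨ih, ENNReal.ofReal_ne_top⟩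

theorem User.IsThresholdPolicy.postState_succ {u : User} {xbar : ℝ} {T : Policy} (hx : 0 < xbar)
    (hT : u.IsThresholdPolicy xbar T) (n : ℕ) :
    u.postState T (n + 1) = u.b * max xbar (u.postState T n) := by
  have hy := u.postState_pos T n
  rw [User.postState, hT.start_succ hx, ENNReal.add_sub_cancel_left (hT.start_ne_top hx n),
    ENNReal.toReal_ofReal (u.wait_nonneg hy), u.flow_wait hx hy]

/-- A threshold policy exists for every positive threshold: the waiting times do not accumulate, as
they are eventually constant and positive. -/
theorem User.exists_isThresholdPolicy (u : User) {xbar : ℝ} (hx : 0 < xbar) :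
    ∃ T, u.IsThresholdPolicy xbar T := by
  have hb := u.b_pos
  let y : ℕ → ℝ := fun n => Nat.rec u.x₀ (fun _ z => u.b * max xbar z) n
  have hysucc : ∀ n, y (n + 1) = u.b * max xbar (y n) := fun n => rfl
  have hypos : ∀ n, 0 < y n := by
    intro n
    cases n with
    | zero => exact u.x₀_pos
    | succ n => rw [hysucc]; exact mul_pos hb (lt_max_of_lt_left hx)
  have hw : ∀ n, 0 ≤ u.wait xbar (y n) := fun n => u.wait_nonneg (hypos n)
  obtain ⟨m, hm⟩ := u.exists_forall_ge_eq hx hysucc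
  have hlim : Tendsto (fun n => ∑ i ∈ Finset.range n, u.wait xbar (y i)) atTop atTop := by
    rw [← not_summable_iff_tendsto_nat_atTop_of_nonneg hw]
    intro hs
    have hlt : u.b * xbar < xbar := mul_lt_of_lt_one_left hx u.b_lt_one
    have h1 : Tendsto (fun n => u.wait xbar (y n)) atTop (𝓝 (u.wait xbar (u.b * xbar))) :=
      tendsto_const_nhds.congr' ((eventually_ge_atTop m).mono fun n hn => by simp only [hm n hn])
    have h2 := tendsto_nhds_unique h1 hs.tendsto_atTop_zero
    rw [User.wait, if_pos hlt] at h2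
    exact (u.hitTime_pos (mul_pos hb hx) hlt).ne' h2
  let T : Policy :=
    { time := fun n => ENNReal.ofReal (∑ i ∈ Finset.range (n + 1), u.wait xbar (y i))
      mono := fun i j hij => ENNReal.ofReal_le_ofReal
        (Finset.sum_le_sum_of_subset_of_nonneg (Finset.range_subset_range.2 (by omega))
          fun k _ _ => hw k)
      tendsto_top := ENNReal.tendsto_ofReal_atTop.comp (hlim.comp (tendsto_add_atTop_nat 1)) }
  have hstart : ∀ n, T.start n = ENNReal.ofReal (∑ i ∈ Finset.range n, u.wait xbar (y i)) := by
    intro n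
    cases n with
    | zero => simp [Policy.start]
    | succ n => rfl
  have hsucc : ∀ n, T.start (n + 1) = T.start n + ENNReal.ofReal (u.wait xbar (y n)) := by
    intro n
    rw [hstart, hstart, Finset.sum_range_succ,
      ENNReal.ofReal_add (Finset.sum_nonneg fun i _ => hw i) (hw n)]
  have hpost : ∀ n, u.postState T n = y n := by
    intro n
    induction n with
    | zero => rfl
    | succ n ih =>
      rw [User.postState, hsucc, ih, ENNReal.add_sub_cancel_left (by rw [hstart]; simp),
        ENNReal.toReal_ofReal (hw n), u.flow_wait hx (hypos n), hysucc]
  refine ⟨T, fun n => ⟨u.wait xbar (y n), ?_, hsucc n⟩⟩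
  rw [hpost]
  exact u.isLeast_wait hx (hypos n)

theorem Policy.start_mono (T : Policy) : Monotone T.start := by
  refine monotone_nat_of_le_succ fun n => ?_
  cases n with
  | zero => exact zero_le
  | succ n => exact T.mono n.le_succ

theorem User.state_eq (u : User) (T : Policy) {n : ℕ} {t : ℝ}
    (h1 : T.start n < ENNReal.ofReal t) (h2 : ENNReal.ofReal t ≤ T.start (n + 1)) :
    u.state T t = u.flow (u.postState T n) (t - (T.start n).toReal) := by
  have hc : T.count t = n := by
    have e : {i : ℕ | T.time i < ENNReal.ofReal t} = (Finset.range n : Set ℕ) := by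
      ext i
      simp only [Set.mem_ofPred_eq, Finset.coe_range, Set.mem_Iio]
      constructor
      · intro hi
        by_contra! hn
        exact absurd hi (not_lt.2 (h2.trans (T.mono hn)))
      · intro hi
        exact lt_of_le_of_lt (T.start_mono (Nat.succ_le_of_lt hi)) h1
    rw [Policy.count, e, Set.ncard_coe_finset, Finset.card_range]
  rw [User.state, hc]

theorem User.IsThresholdPolicy.intervalIntegrable {u : User} {xbar : ℝ} {T : Policy}
    (hx : 0 < xbar) (hT : u.IsThresholdPolicy xbar T) {φ : ℝ → ℝ}
    (hφ : ContinuousOn φ (Set.Ioi 0)) (n : ℕ) :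
    IntervalIntegrable (fun t => φ (u.state T t)) MeasureTheory.volume 0 (T.start n).toReal := by
  induction n with
  | zero => simp [Policy.start]
  | succ n ih =>
    refine ih.trans ?_
    have hy := u.postState_pos T n
    have hle : (T.start n).toReal ≤ (T.start (n + 1)).toReal :=
      ENNReal.toReal_mono (hT.start_ne_top hx _) (T.start_mono n.le_succ)
    have hc : ContinuousOn (fun t => φ (u.flow (u.postState T n) (t - (T.start n).toReal)))
        (Set.uIcc (T.start n).toReal (T.start (n + 1)).toReal) := by
      rw [Set.uIcc_of_le hle]
      refine hφ.comp ((u.continuousOn_flow hy).comp (by fun_prop) ?_) ?_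
      · exact fun t ht => sub_nonneg.2 ht.1
      · exact fun t ht => u.flow_pos hy (sub_nonneg.2 ht.1)
    refine hc.intervalIntegrable.congr fun t ht => ?_
    rw [Set.uIoc_of_le hle] at ht
    rw [u.state_eq T ((ENNReal.lt_ofReal_iff_toReal_lt (hT.start_ne_top hx _)).2 ht.1)
      (ENNReal.ofReal_le_of_le_toReal ht.2)]

/-! ### Long-run averages -/

/-- The difference between `∫₀^τ g` and `τ` times the mean of `g` over a period is continuous and
periodic, hence bounded. -/
theorem tendsto_average_of_periodic {g : ℝ → ℝ} {P : ℝ} (hP : 0 < P)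
    (hg : Function.Periodic g P) (hint : IntervalIntegrable g MeasureTheory.volume 0 P) :
    Tendsto (fun τ => (1 / τ) * ∫ t in (0 : ℝ)..τ, g t) atTop
      (𝓝 ((1 / P) * ∫ t in (0 : ℝ)..P, g t)) := by
  have hi := hg.intervalIntegrable₀ hP.ne' hint
  set A := (1 / P) * ∫ t in (0 : ℝ)..P, g t with hA
  let D : ℝ → ℝ := fun τ => (∫ t in (0 : ℝ)..τ, g t) - τ * A
  have hD : Continuous D := (intervalIntegral.continuous_primitive hi 0).sub (by fun_prop)
  have hper : Function.Periodic D P := by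
    intro τ
    have h1 := hg.intervalIntegral_add_eq_add 0 τ hi
    rw [zero_add] at h1
    simp only [D]
    rw [h1, hA]
    field_simp
    ring
  obtain ⟨C, hC⟩ := isCompact_Icc.exists_bound_of_continuousOn (s := Set.Icc 0 P) hD.continuousOn
  have hbd : ∀ τ, |D τ| ≤ C := by
    intro τ
    obtain ⟨s, hs, e⟩ := hper.exists_mem_Ico₀ hP τ
    rw [e]
    exact hC s (Set.Ico_subset_Icc_self hs)
  have hz : Tendsto (fun τ => τ⁻¹ * D τ) atTop (𝓝 0) :=
    tendsto_inv_atTop_zero.zero_mul_isBoundedUnder_le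
      (isBoundedUnder_of ⟨C, hbd⟩)
  have h := hz.add_const A
  rw [zero_add] at h
  refine h.congr' ((eventually_gt_atTop 0).mono fun τ hτ => ?_)
  simp only [D]
  field_simp
  ring

/-- The long-run average of an eventually periodic function. -/
theorem tendsto_average_of_eventually_periodic {f g : ℝ → ℝ} {P t₀ : ℝ} (hP : 0 < P)
    (hg : Function.Periodic g P) (hint : IntervalIntegrable g MeasureTheory.volume t₀ (t₀ + P))
    (hf : IntervalIntegrable f MeasureTheory.volume 0 t₀) (hfg : ∀ t, t₀ < t → f t = g t) :
    Tendsto (fun τ => (1 / τ) * ∫ t in (0 : ℝ)..τ, f t) atTop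
      (𝓝 ((1 / P) * ∫ t in t₀..(t₀ + P), g t)) := by
  have hi := hg.intervalIntegrable hP.ne' hint
  have h := tendsto_average_of_periodic hP hg (hi 0 P)
  have e : (∫ t in (0 : ℝ)..P, g t) = ∫ t in t₀..(t₀ + P), g t := by
    have := hg.intervalIntegral_add_eq 0 t₀
    rwa [zero_add] at this
  rw [e] at h
  have hz : Tendsto (fun τ : ℝ => τ⁻¹ * ((∫ t in (0 : ℝ)..t₀, f t) - ∫ t in (0 : ℝ)..t₀, g t))
      atTop (𝓝 0) := by
    simpa using tendsto_inv_atTop_zero.mul_const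
      ((∫ t in (0 : ℝ)..t₀, f t) - ∫ t in (0 : ℝ)..t₀, g t)
  have h2 := h.add hz
  rw [add_zero] at h2
  refine h2.congr' ((eventually_ge_atTop t₀).mono fun τ hτ => ?_)
  have heq : Set.EqOn g f (Set.uIoc t₀ τ) := by
    intro t ht
    rw [Set.uIoc_of_le hτ] at ht
    exact (hfg t ht.1).symm
  have hfi : IntervalIntegrable f MeasureTheory.volume t₀ τ := (hi t₀ τ).congr heq
  have h3 : (∫ t in t₀..τ, f t) = ∫ t in t₀..τ, g t :=
    intervalIntegral.integral_congr_ae (MeasureTheory.ae_of_all _ fun t ht => (heq ht).symm)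
  have h4 := intervalIntegral.integral_add_adjacent_intervals hf hfi
  have h5 := intervalIntegral.integral_add_adjacent_intervals (hi 0 t₀) (hi t₀ τ)
  simp only [one_div]
  rw [← h4, ← h5, h3]
  ring

theorem User.IsThresholdPolicy.tendsto_average {u : User} {xbar : ℝ} {T : Policy}
    (hx : 0 < xbar) (hT : u.IsThresholdPolicy xbar T) {φ : ℝ → ℝ}
    (hφ : ContinuousOn φ (Set.Ioi 0)) :
    Tendsto (fun τ => (1 / τ) * ∫ t in (0 : ℝ)..τ, φ (u.state T t)) atTop
      (𝓝 ((1 / u.hitTime xbar (u.b * xbar)) *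
        ∫ t in (0 : ℝ)..u.hitTime xbar (u.b * xbar), φ (u.flow (u.b * xbar) t))) := by
  have hb := u.b_pos
  have hlt : u.b * xbar < xbar := mul_lt_of_lt_one_left hx u.b_lt_one
  have hy : 0 < u.b * xbar := mul_pos hb hx
  have hP : 0 < u.hitTime xbar (u.b * xbar) := u.hitTime_pos hy hlt
  set P := u.hitTime xbar (u.b * xbar) with hPdef
  obtain ⟨m, hm⟩ := u.exists_forall_ge_eq hx (hT.postState_succ hx)
  set t₀ := (T.start m).toReal with ht₀
  have ht₀0 : 0 ≤ t₀ := ENNReal.toReal_nonneg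
  have hstart : ∀ k : ℕ, T.start (m + k) = ENNReal.ofReal (t₀ + k * P) := by
    intro k
    induction k with
    | zero => simp [ht₀, ENNReal.ofReal_toReal (hT.start_ne_top hx m)]
    | succ k ih =>
      rw [← add_assoc, hT.start_succ hx, ih, hm (m + k) (by omega), User.wait, if_pos hlt,
        ← ENNReal.ofReal_add (by positivity) hP.le]
      congr 1
      push_cast
      ring
  -- The post-transient allocation, extended to a periodic function on the whole line.
  let g : ℝ → ℝ := fun t => φ (u.flow (u.b * xbar) (toIocMod hP 0 (t - t₀)))
  have hg : Function.Periodic g P := by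
    intro t
    simp only [g]
    rw [add_sub_right_comm, toIocMod_add_right]
  have hg1 : ∀ t ∈ Set.Ioc t₀ (t₀ + P), g t = φ (u.flow (u.b * xbar) (t - t₀)) := by
    intro t ht
    simp only [g]
    rw [(toIocMod_eq_self hP).2 ⟨by linarith [ht.1], by linarith [ht.2]⟩]
  have hfg : ∀ t, t₀ < t → φ (u.state T t) = g t := by
    intro t ht
    have hmem := toIocMod_mem_Ioc hP 0 (t - t₀)
    have hdiv := toIocMod_add_toIocDiv_zsmul hP 0 (t - t₀)
    rw [zero_add] at hmem
    rw [zsmul_eq_mul] at hdiv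
    have hnn : 0 ≤ toIocDiv hP 0 (t - t₀) := by
      by_contra! hneg
      have h1 : (toIocDiv hP 0 (t - t₀) : ℝ) ≤ -1 := by exact_mod_cast Int.le_sub_one_of_lt hneg
      nlinarith [hmem.2]
    obtain ⟨k, hk⟩ := Int.eq_ofNat_of_zero_le hnn
    rw [hk, Int.cast_natCast] at hdiv
    have hkP : 0 ≤ t₀ + k * P := by positivity
    rw [u.state_eq T (n := m + k), hm (m + k) (by omega), hstart, ENNReal.toReal_ofReal hkP]
    · simp only [g]
      congr 2
      linarith
    · rw [hstart, ENNReal.ofReal_lt_ofReal_iff (by linarith)]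
      linarith [hmem.1]
    · rw [add_assoc, hstart]
      refine ENNReal.ofReal_le_ofReal ?_
      push_cast
      linarith [hmem.2]
  have hle : t₀ ≤ t₀ + P := by linarith
  have hint : IntervalIntegrable g MeasureTheory.volume t₀ (t₀ + P) := by
    have hc : ContinuousOn (fun t => φ (u.flow (u.b * xbar) (t - t₀)))
        (Set.uIcc t₀ (t₀ + P)) := by
      rw [Set.uIcc_of_le hle]
      refine hφ.comp ((u.continuousOn_flow hy).comp (by fun_prop) ?_) ?_
      · exact fun t ht => sub_nonneg.2 ht.1
      · exact fun t ht => u.flow_pos hy (sub_nonneg.2 ht.1)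
    refine hc.intervalIntegrable.congr fun t ht => ?_
    rw [Set.uIoc_of_le hle] at ht
    exact (hg1 t ht).symm
  have hlim := tendsto_average_of_eventually_periodic hP hg hint
    (hT.intervalIntegrable hx hφ m) hfg
  have e : (∫ t in t₀..(t₀ + P), g t) = ∫ t in (0 : ℝ)..P, φ (u.flow (u.b * xbar) t) := by
    rw [intervalIntegral.integral_congr_ae (g := fun t => φ (u.flow (u.b * xbar) (t - t₀)))
      (MeasureTheory.ae_of_all _ fun t ht => hg1 t (by rwa [Set.uIoc_of_le hle] at ht)),
      intervalIntegral.integral_comp_sub_right (fun t => φ (u.flow (u.b * xbar) t))]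
    simp
  rwa [e] at hlim

/-- The long-run average of `x(t) ^ p` under the policy with threshold `xbar`. -/
theorem User.IsThresholdPolicy.tendsto_average_rpow {u : User} {xbar p : ℝ} {T : Policy}
    (hx : 0 < xbar) (hT : u.IsThresholdPolicy xbar T) (hp : p + 1 - u.γ ≠ 0) :
    Tendsto (fun τ => (1 / τ) * ∫ t in (0 : ℝ)..τ, u.state T t ^ p) atTop
      (𝓝 (u.moment p / u.moment 0 * xbar ^ p)) := by
  have h := hT.tendsto_average hx (φ := fun x => x ^ p)
    (continuousOn_id.rpow_const fun x hx => Or.inl (ne_of_gt hx))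
  rw [u.integral_flow_rpow hx hp, u.hitTime_b_mul hx] at h
  convert h using 2
  have e : xbar ^ (p + 1 - u.γ) = xbar ^ p * xbar ^ (1 - u.γ) := by
    rw [← Real.rpow_add hx]; congr 1; ring
  have h0 := u.moment_pos 0
  have ha := u.a_pos
  have hxp := Real.rpow_pos_of_pos hx (1 - u.γ)
  rw [e]
  field_simp

theorem User.IsThresholdPolicy.J_eq {u : User} {xbar α : ℝ} {T : Policy}
    (hx : 0 < xbar) (hT : u.IsThresholdPolicy xbar T) (hu : 2 - α - u.γ ≠ 0) :
    u.J α T = (u.moment (1 - α) / u.moment 0 * (xbar ^ (1 - α) / (1 - α)) : ℝ) := by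
  have h := (hT.tendsto_average_rpow hx (p := 1 - α)
    (by convert hu using 1; ring)).div_const (1 - α)
  have h2 := ((continuous_coe_real_ereal.tendsto _).comp h).liminf_eq
  rw [mul_div_assoc] at h2
  rw [← h2, User.J]
  refine congrArg (fun F : ℝ → EReal => liminf F atTop) (funext fun τ => ?_)
  simp only [Function.comp, intervalIntegral.integral_div, mul_div_assoc]

theorem User.IsThresholdPolicy.G_eq {u : User} {xbar : ℝ} {T : Policy}
    (hx : 0 < xbar) (hT : u.IsThresholdPolicy xbar T) :
    u.G T = (u.moment 1 / u.moment 0 * xbar : ℝ) := by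
  have h := hT.tendsto_average_rpow hx (p := 1) (by linarith [u.γ_le_one])
  simp only [Real.rpow_one] at h
  exact ((continuous_coe_real_ereal.tendsto _).comp h).limsup_eq

/-! ### The performance curve -/

/-- The curve traced by the points `(-J, G)` of the policies with threshold `x > 0`. -/
noncomputable def User.point (u : User) (α x : ℝ) : ℝ × ℝ :=
  (-(u.moment (1 - α) / u.moment 0 * (x ^ (1 - α) / (1 - α))), u.moment 1 / u.moment 0 * x)

theorem User.moment_of_ne (u : User) {p : ℝ} (hp : p + 1 - u.γ ≠ 0) :
    u.moment p = (1 - u.b ^ (p + 1 - u.γ)) / (p + 1 - u.γ) := if_neg hp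

theorem User.moment_one (u : User) : u.moment 1 = (1 - u.b ^ (2 - u.γ)) / (2 - u.γ) := by
  have h := u.moment_of_ne (p := 1) (by linarith [u.γ_le_one])
  rwa [one_add_one_eq_two] at h

theorem User.moment_one_sub (u : User) {α : ℝ} (hu : 2 - α - u.γ ≠ 0) :
    u.moment (1 - α) = (1 - u.b ^ (2 - α - u.γ)) / (2 - α - u.γ) := by
  have e : 1 - α + 1 - u.γ = 2 - α - u.γ := by ring
  rw [u.moment_of_ne (by rwa [e]), e]

theorem User.threshold_eq (u : User) {α lam : ℝ} (hu : 2 - α - u.γ ≠ 0) :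
    u.threshold α lam = (u.moment (1 - α) / u.moment 1 / lam) ^ (1 / α) := by
  rw [u.moment_one, u.moment_one_sub hu, User.threshold]
  congr 1
  rw [div_div_div_eq, div_div]
  congr 1 <;> ring

theorem User.threshold_pos (u : User) {α lam : ℝ} (hu : 2 - α - u.γ ≠ 0) (hlam : 0 < lam) :
    0 < u.threshold α lam := by
  rw [u.threshold_eq hu]
  exact Real.rpow_pos_of_pos
    (div_pos (div_pos (u.moment_pos _) (u.moment_pos _)) hlam) _

/-- The first-order condition that makes the threshold optimal for the price `lam`. -/
theorem User.threshold_rpow (u : User) {α lam : ℝ} (hα : 0 < α) (hu : 2 - α - u.γ ≠ 0)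
    (hlam : 0 < lam) :
    u.moment (1 - α) * u.threshold α lam ^ (-α) = lam * u.moment 1 := by
  have h1 := u.moment_pos 1
  have h2 := u.moment_pos (1 - α)
  rw [u.threshold_eq hu, ← Real.rpow_mul (by positivity),
    show 1 / α * -α = -1 by field_simp, Real.rpow_neg_one]
  field_simp

theorem User.threshold_surjective (u : User) {α x : ℝ} (hα : 0 < α) (hu : 2 - α - u.γ ≠ 0)
    (hx : 0 < x) : ∃ lam, 0 < lam ∧ u.threshold α lam = x := by
  have h1 := u.moment_pos 1
  have h2 := u.moment_pos (1 - α)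
  have hxα := Real.rpow_pos_of_pos hx α
  refine ⟨u.moment (1 - α) / u.moment 1 / x ^ α, by positivity, ?_⟩
  rw [u.threshold_eq hu, div_div_cancel₀ (by positivity), ← Real.rpow_mul hx.le,
    mul_one_div_cancel hα.ne', Real.rpow_one]

theorem User.mem_performanceCurve (u : User) {α : ℝ} (hα : 0 < α) (hu : 2 - α - u.γ ≠ 0)
    {p : ℝ × ℝ} : p ∈ u.performanceCurve α ↔ ∃ x, 0 < x ∧ p = u.point α x := by
  have key : ∀ {x : ℝ} {T : Policy}, 0 < x → u.IsThresholdPolicy x T →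
      ((p.1 : EReal) = -u.J α T ∧ (p.2 : EReal) = u.G T ↔ p = u.point α x) := by
    intro x T hx hT
    rw [hT.J_eq hx hu, hT.G_eq hx, ← EReal.coe_neg, EReal.coe_eq_coe_iff, EReal.coe_eq_coe_iff,
      Prod.ext_iff, User.point]
  constructor
  · rintro ⟨lam, hlam, T, hT, h⟩
    exact ⟨_, u.threshold_pos hu hlam, (key (u.threshold_pos hu hlam) hT).1 h⟩
  · rintro ⟨x, hx, h⟩
    obtain ⟨T, hT⟩ := u.exists_isThresholdPolicy hx
    obtain ⟨lam, hlam, rfl⟩ := u.threshold_surjective hα hu hx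
    exact ⟨lam, hlam, T, hT, (key hx hT).2 h⟩

/-! ### Minimizing the Lagrangian -/

/-- For `q < 1`, `q ≠ 0`, the function `y - y ^ q / q` is minimal at `y = 1`. -/
theorem one_sub_one_div_le_sub_rpow_div {q y : ℝ} (hq : q < 1) (hq0 : q ≠ 0) (hy : 0 < y) :
    1 - 1 / q ≤ y - y ^ q / q := by
  rcases lt_or_gt_of_ne hq0 with h | h
  · -- Bernoulli's inequality at `1 / y` with exponent `1 - q > 1`, multiplied by `y`.
    have hB := one_add_mul_self_le_rpow_one_add (s := y⁻¹ - 1) (by linarith [inv_pos.2 hy])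
      (p := 1 - q) (by linarith)
    rw [add_sub_cancel, Real.inv_rpow hy.le, ← Real.rpow_neg hy.le] at hB
    have hm := mul_le_mul_of_nonneg_right hB hy.le
    have e : y ^ (-(1 - q)) * y = y ^ q := by
      rw [← Real.rpow_add_one hy.ne']; congr 1; ring
    rw [e] at hm
    have e2 : (1 + (1 - q) * (y⁻¹ - 1)) * y = 1 + q * (y - 1) := by field_simp; ring
    rw [e2] at hm
    have := div_le_div_of_nonpos_of_le h.le hm
    rw [add_div, mul_div_cancel_left₀ _ hq0] at this
    linarith
  · have hB := rpow_one_add_le_one_add_mul_self (s := y - 1) (by linarith) h.le hq.le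
    rw [add_sub_cancel] at hB
    have := div_le_div_of_nonneg_right hB h.le
    rw [add_div, mul_div_cancel_left₀ _ hq0] at this
    linarith

/-- The threshold `x̄(lam)` minimizes the one-user Lagrangian over the performance curve. -/
theorem User.lagrangian_threshold_le (u : User) {α lam x : ℝ} (hα : 0 < α) (hα1 : α ≠ 1)
    (hu : 2 - α - u.γ ≠ 0) (hlam : 0 < lam) (hx : 0 < x) :
    (u.point α (u.threshold α lam)).1 + lam * (u.point α (u.threshold α lam)).2 ≤
      (u.point α x).1 + lam * (u.point α x).2 := by
  have hs := u.threshold_pos hu hlam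
  have hfoc := u.threshold_rpow hα hu hlam
  set s := u.threshold α lam
  obtain ⟨y, hy, rfl⟩ : ∃ y, 0 < y ∧ x = s * y := ⟨x / s, div_pos hx hs, by field_simp⟩
  have h0 := u.moment_pos 0
  have h2 := u.moment_pos (1 - α)
  have hB := one_sub_one_div_le_sub_rpow_div (q := 1 - α) (by linarith)
    (sub_ne_zero.2 hα1.symm) hy
  have e : s ^ (1 - α) = s * s ^ (-α) := by
    rw [sub_eq_add_neg, Real.rpow_add hs, Real.rpow_one]
  have hsα := Real.rpow_pos_of_pos hs (-α)
  -- After scaling by the first-order condition, both sides are multiples of the same constant.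
  have hval : ∀ z, 0 < z → (u.point α (s * z)).1 + lam * (u.point α (s * z)).2 =
      u.moment (1 - α) / u.moment 0 * (s * s ^ (-α)) * (z - z ^ (1 - α) / (1 - α)) := by
    intro z hz
    simp only [User.point]
    rw [Real.mul_rpow hs.le hz.le, e]
    linear_combination (-(s * z / u.moment 0)) * hfoc
  have h1 := hval 1 one_pos
  rw [mul_one, Real.one_rpow] at h1
  rw [h1, hval y hy]
  exact mul_le_mul_of_nonneg_left hB (by positivity)

/-- A linear functional has the same lower bounds on a set and on its convex hull. -/
theorem le_add_mul_of_mem_convexHull {S : Set (ℝ × ℝ)} {l m : ℝ}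
    (h : ∀ p ∈ S, m ≤ p.1 + l * p.2) {p : ℝ × ℝ} (hp : p ∈ convexHull ℝ S) :
    m ≤ p.1 + l * p.2 := by
  have hc : Convex ℝ {p : ℝ × ℝ | m ≤ p.1 + l * p.2} :=
    convex_halfSpace_ge (𝕜 := ℝ) (f := fun p : ℝ × ℝ => p.1 + l * p.2)
      ⟨fun p q => by simp only [Prod.fst_add, Prod.snd_add]; ring,
        fun c p => by simp only [Prod.smul_fst, Prod.smul_snd, smul_eq_mul]; ring⟩ m
  exact convexHull_min h hc hp

/-- A price for which the first-order condition holds at `x` is the only one for which `x`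
minimizes the one-user Lagrangian. -/
theorem User.eq_of_threshold_minimizes (u : User) {α lam lam' : ℝ} (hα : 0 < α)
    (hα1 : α ≠ 1) (hu : 2 - α - u.γ ≠ 0) (hlam : 0 < lam)
    (h : ∀ x, 0 < x → (u.point α (u.threshold α lam)).1 +
      lam' * (u.point α (u.threshold α lam)).2 ≤ (u.point α x).1 + lam' * (u.point α x).2) :
    lam' = lam := by
  have hs := u.threshold_pos hu hlam
  have hfoc := u.threshold_rpow hα hu hlam
  set s := u.threshold α lam
  have h0 := u.moment_pos 0
  have h1 := u.moment_pos 1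
  have hmin : IsLocalMin (fun x => (u.point α x).1 + lam' * (u.point α x).2) s := by
    filter_upwards [lt_mem_nhds hs] with x hx using h x hx
  have hd : HasDerivAt (fun x => (u.point α x).1 + lam' * (u.point α x).2)
      (-(u.moment (1 - α) / u.moment 0 * ((1 - α) * s ^ (1 - α - 1) / (1 - α))) +
        lam' * (u.moment 1 / u.moment 0 * 1)) s :=
    (((Real.hasDerivAt_rpow_const (Or.inl hs.ne')).div_const _).const_mul _).neg.add
      (((hasDerivAt_id s).const_mul _).const_mul _)
  have hz := hmin.hasDerivAt_eq_zero hd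
  rw [mul_div_cancel_left₀ _ (sub_ne_zero.2 hα1.symm), show 1 - α - 1 = -α by ring] at hz
  have hz' : u.moment (1 - α) * s ^ (-α) = lam' * u.moment 1 := by
    field_simp at hz
    linarith
  exact mul_right_cancel₀ h1.ne' (hz'.symm.trans hfoc)

/-! ### The multiplier -/

/-- The cases `γ = 1` and `γ ≠ 1` of `λ*` in one formula. The summand of user `k`, times
`lam ^ (-1 / α)`, is the average allocation at the threshold `x̄(lam)`. -/
theorem lambdaStar_eq {N : ℕ} (u : Fin N → User) {α c : ℝ} (hα : 0 < α)
    (hu : ∀ k, 2 - α - (u k).γ ≠ 0) :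
    lambdaStar u α c = 1 / c ^ α * (∑ k, (u k).moment 1 / (u k).moment 0 *
      ((u k).moment (1 - α) / (u k).moment 1) ^ (1 / α)) ^ α := by
  unfold lambdaStar
  congr 2
  rw [← Finset.sum_filter_not_add_sum_filter (Finset.univ : Finset (Fin N))
    (fun k => (u k).γ = 1)]
  congr 1
  · refine Finset.sum_congr rfl fun k hk => ?_
    have hγ : (u k).γ ≠ 1 := (Finset.mem_filter.1 hk).2
    have h1 := (u k).one_sub_γ_pos hγ
    have h0 : (u k).moment 0 = (1 - (u k).b ^ (1 - (u k).γ)) / (1 - (u k).γ) := by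
      rw [(u k).moment_of_ne (by rw [zero_add]; exact h1.ne'), zero_add]
    have hm1 := (u k).moment_pos 1
    have hm2 := (u k).moment_pos (1 - α)
    have hm0 := (u k).moment_pos 0
    rw [← (u k).moment_one_sub (hu k), mul_assoc _ (_ ^ (1 / α)) (_ ^ (1 / α)),
      ← inv_div (1 - (u k).b ^ (2 - (u k).γ)), ← (u k).moment_one,
      ← Real.mul_rpow (by positivity) hm2.le, inv_mul_eq_div, (u k).moment_one, h0]
    congr 1
    rw [div_div_div_eq, div_mul_div_comm]
    congr 1; ring
  · refine Finset.sum_congr rfl fun k hk => ?_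
    have hγ : (u k).γ = 1 := (Finset.mem_filter.1 hk).2
    have h0 : (u k).moment 0 = -Real.log (u k).b := by
      rw [User.moment, if_pos (by rw [hγ]; ring)]
    have h1 : (u k).moment 1 = 1 - (u k).b := by
      rw [(u k).moment_one, hγ, show (2 : ℝ) - 1 = 1 by ring, Real.rpow_one, div_one]
    have h2 : (u k).moment (1 - α) = (1 - (u k).b ^ (1 - α)) / (1 - α) := by
      rw [(u k).moment_one_sub (hu k), hγ, show 2 - α - 1 = 1 - α by ring]
    have hm1 := (u k).moment_pos 1
    have hm2 := (u k).moment_pos (1 - α)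
    have hm0 := (u k).moment_pos 0
    rw [← h2, ← h1, ← h0, Real.div_rpow hm2.le hm1.le,
      show (α - 1) / α = 1 - 1 / α by field_simp, Real.rpow_sub hm1, Real.rpow_one]
    ring

theorem lambdaStar_pos {N : ℕ} (hN : 0 < N) (u : Fin N → User) {α c : ℝ} (hα : 0 < α)
    (hc : 0 < c) (hu : ∀ k, 2 - α - (u k).γ ≠ 0) : 0 < lambdaStar u α c := by
  rw [lambdaStar_eq u hα hu]
  refine mul_pos (one_div_pos.2 (Real.rpow_pos_of_pos hc α)) (Real.rpow_pos_of_pos ?_ α)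
  refine Finset.sum_pos (fun k _ => ?_) ⟨⟨0, hN⟩, Finset.mem_univ _⟩
  have h0 := (u k).moment_pos 0
  have h1 := (u k).moment_pos 1
  have h2 := (u k).moment_pos (1 - α)
  positivity

/-- At the price `λ*` the optimal thresholds exhaust the capacity `c`. -/
theorem sum_point_threshold_lambdaStar {N : ℕ} (hN : 0 < N) (u : Fin N → User) {α c : ℝ}
    (hα : 0 < α) (hc : 0 < c) (hu : ∀ k, 2 - α - (u k).γ ≠ 0) :
    ∑ k, ((u k).point α ((u k).threshold α (lambdaStar u α c))).2 = c := by
  have hpos := lambdaStar_pos hN u hα hc hu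
  have heq := lambdaStar_eq u (c := c) hα hu
  set S := ∑ k, (u k).moment 1 / (u k).moment 0 *
      ((u k).moment (1 - α) / (u k).moment 1) ^ (1 / α) with hS
  have hS0 : 0 ≤ S := Finset.sum_nonneg fun k _ => by
    have h0 := (u k).moment_pos 0
    have h1 := (u k).moment_pos 1
    have h2 := (u k).moment_pos (1 - α)
    positivity
  have hroot : lambdaStar u α c ^ (1 / α) = S / c := by
    rw [heq, one_div_mul_eq_div, ← Real.div_rpow hS0 hc.le, ← Real.rpow_mul (by positivity),
      mul_one_div_cancel hα.ne', Real.rpow_one]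
  have hSpos : 0 < S := by
    have := Real.rpow_pos_of_pos hpos (1 / α)
    rw [hroot] at this
    exact (div_pos_iff_of_pos_right hc).1 this
  calc ∑ k, ((u k).point α ((u k).threshold α (lambdaStar u α c))).2
      = ∑ k, (u k).moment 1 / (u k).moment 0 *
          ((u k).moment (1 - α) / (u k).moment 1) ^ (1 / α) / (S / c) := by
        refine Finset.sum_congr rfl fun k _ => ?_
        have h1 := (u k).moment_pos 1
        have h2 := (u k).moment_pos (1 - α)
        rw [User.point, (u k).threshold_eq (hu k), Real.div_rpow (by positivity) hpos.le, hroot,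
          mul_div_assoc]
    _ = c := by
        rw [← Finset.sum_div, ← hS]
        field_simp

/-- Saddle-point characterization of geometric multipliers: if the minimizer `ω₀` of the Lagrangian
for one multiplier `lam₀` uses up the constraint, then the multipliers are exactly those `lam` whose
Lagrangian is minimized by `ω₀`. -/
theorem isGeometricMultiplier_iff {X : Type*} {Ω : Set X} {f g : X → ℝ} {lam₀ : ℝ} {ω₀ : X}
    (hω₀ : ω₀ ∈ Ω) (hg : g ω₀ = 0) (hlam₀ : 0 ≤ lam₀)
    (hmin : ∀ ω ∈ Ω, f ω₀ ≤ f ω + lam₀ * g ω) {lam : ℝ} :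
    IsGeometricMultiplier Ω f g lam ↔ 0 ≤ lam ∧ ∀ ω ∈ Ω, f ω₀ ≤ f ω + lam * g ω := by
  have hprimal : (⨅ ω ∈ {ω ∈ Ω | g ω ≤ 0}, (f ω : EReal)) = (f ω₀ : EReal) := by
    refine le_antisymm (iInf₂_le ω₀ ⟨hω₀, hg.le⟩) (le_iInf₂ fun ω hω => ?_)
    rw [EReal.coe_le_coe_iff]
    linarith [hmin ω hω.1, mul_nonpos_of_nonneg_of_nonpos hlam₀ hω.2]
  rw [IsGeometricMultiplier, hprimal]
  refine and_congr_right fun _ => ⟨fun h ω hω => ?_, fun h => le_antisymm ?_ ?_⟩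
  · rw [← EReal.coe_le_coe_iff, h]
    exact iInf₂_le (f := fun ω (_ : ω ∈ Ω) => ((f ω + lam * g ω : ℝ) : EReal)) ω hω
  · exact le_iInf₂ fun ω hω => EReal.coe_le_coe_iff.2 (h ω hω)
  · refine (iInf₂_le ω₀ hω₀).trans ?_
    rw [hg, mul_zero, add_zero]

end GAIMD

theorem mainTheorem2 (N : ℕ) (hN : 0 < N) (α c : ℝ) (hα : 0 < α) (hα1 : α ≠ 1) (hc : 0 < c)
    (u : Fin N → GAIMD.User) (hu : ∀ k, 2 - α - (u k).γ ≠ 0) :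
    GAIMD.IsGeometricMultiplier (GAIMD.performanceSpace u α) GAIMD.negJtilde
        (fun ω => GAIMD.Gtilde ω - c) (GAIMD.lambdaStar u α c) ∧
      ∀ lam : ℝ, GAIMD.IsGeometricMultiplier (GAIMD.performanceSpace u α) GAIMD.negJtilde
        (fun ω => GAIMD.Gtilde ω - c) lam → lam = GAIMD.lambdaStar u α c := by
  have hpos := GAIMD.lambdaStar_pos hN u hα hc hu
  have hsum := GAIMD.sum_point_threshold_lambdaStar hN u hα hc hu
  set L := GAIMD.lambdaStar u α c
  have hLag : ∀ (l : ℝ) (ω : Fin N → ℝ × ℝ), GAIMD.negJtilde ω + l * (GAIMD.Gtilde ω - c) =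
      ∑ k, ((ω k).1 + l * (ω k).2) - l * c := by
    intro l ω
    rw [Finset.sum_add_distrib, ← Finset.mul_sum, GAIMD.negJtilde, GAIMD.Gtilde]
    ring
  let ω₀ : Fin N → ℝ × ℝ := fun k => (u k).point α ((u k).threshold α L)
  have hcurve : ∀ k x, 0 < x → (u k).point α x ∈ convexHull ℝ ((u k).performanceCurve α) :=
    fun k x hx => subset_convexHull ℝ _ (((u k).mem_performanceCurve hα (hu k)).2 ⟨x, hx, rfl⟩)
  have hthr : ∀ k, 0 < (u k).threshold α L := fun k => (u k).threshold_pos (hu k) hpos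
  have hω₀ : ω₀ ∈ GAIMD.performanceSpace u α := fun k _ => hcurve k _ (hthr k)
  have hg : GAIMD.Gtilde ω₀ - c = 0 := sub_eq_zero.2 hsum
  have hval : ∀ l : ℝ, GAIMD.negJtilde ω₀ = ∑ k, ((ω₀ k).1 + l * (ω₀ k).2) - l * c := by
    intro l
    rw [← hLag, hg, mul_zero, add_zero]
  have hmin : ∀ ω ∈ GAIMD.performanceSpace u α,
      GAIMD.negJtilde ω₀ ≤ GAIMD.negJtilde ω + L * (GAIMD.Gtilde ω - c) := by
    intro ω hω
    rw [hLag, hval L]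
    refine sub_le_sub_right (Finset.sum_le_sum fun k _ => ?_) _
    refine GAIMD.le_add_mul_of_mem_convexHull (fun p hp => ?_) (hω k (Set.mem_univ k))
    obtain ⟨x, hx, rfl⟩ := ((u k).mem_performanceCurve hα (hu k)).1 hp
    exact (u k).lagrangian_threshold_le hα hα1 (hu k) hpos hx
  have hiff := fun lam => GAIMD.isGeometricMultiplier_iff (f := GAIMD.negJtilde)
    (g := fun ω => GAIMD.Gtilde ω - c) (lam := lam) hω₀ hg hpos.le hmin
  refine ⟨(hiff L).2 ⟨hpos.le, hmin⟩, fun lam hlam => ?_⟩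
  -- Changing the threshold of a single user already determines the multiplier.
  let k₀ : Fin N := ⟨0, hN⟩
  refine (u k₀).eq_of_threshold_minimizes hα hα1 (hu k₀) hpos fun x hx => ?_
  have h := ((hiff lam).1 hlam).2 (Function.update ω₀ k₀ ((u k₀).point α x)) (by
    intro k _
    rcases eq_or_ne k k₀ with rfl | hk
    · rw [Function.update_self]; exact hcurve _ x hx
    · rw [Function.update_of_ne hk]; exact hω₀ k (Set.mem_univ k))
  rw [hLag, hval lam, ← Finset.add_sum_erase _ _ (Finset.mem_univ k₀),
    ← Finset.add_sum_erase _ _ (Finset.mem_univ k₀), Function.update_self] at h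
  have hrest : ∑ k ∈ Finset.univ.erase k₀, ((Function.update ω₀ k₀ ((u k₀).point α x) k).1 +
      lam * (Function.update ω₀ k₀ ((u k₀).point α x) k).2) =
      ∑ k ∈ Finset.univ.erase k₀, ((ω₀ k).1 + lam * (ω₀ k).2) :=
    Finset.sum_congr rfl fun k hk => by rw [Function.update_of_ne (Finset.ne_of_mem_erase hk)]
  rw [hrest] at h
  linarith
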